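/- Call a relation $R\subseteq\mathbb{Q}^k$ ($k\ge 1$) temporal if it is first-order definable (without parameters) in $(\mathbb{Q};<)$. Let $\alpha,\beta,\gamma:\mathbb{Q}\to\mathbb{Q}$ be strictly increasing maps such that $\gamma(a)<\alpha(a)<\beta(a)<\gamma(a+\varepsilon)$ for all $a,\varepsilon\in\mathbb{Q}$ with $\varepsilon>0$, and let $\mathrm{mix}:\mathbb{Q}^2\to\mathbb{Q}$ be the operation with $\mathrm{mix}(x,y)=\alpha(x)$ if $x<y$, $\mathrm{mix}(x,y)=\beta(x)$ if $x=y$, and $\mathrm{mix}(x,y)=\gamma(y)$ if $x>y$. For $n\ge 3$ let $$\phi^{\mathrm{mix}}_n(x_1,\dots,x_n):=\Big(x_1\ge x_2\vee\bigvee_{i=3}^n x_1>x_i\Big)\wedge\Big(x_2\ge x_1\vee\bigvee_{i=3}^n x_2>x_i\Big).$$ Theorem. A temporal relation $R\subseteq\mathbb{Q}^k$ is preserved by $\mathrm{mix}$ (that is, applying $\mathrm{mix}$ componentwise to any two tuples of $R$ gives a tuple of $R$) if and only if $R$ can be defined by a finite conjunction of clauses, each of one of the following two forms: 1. $\displaystyle\bigvee_{i=1}^n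 x\neq z_i\ \vee\ \bigvee_{i=1}^m x>y_i$ with $n,m\ge 0$; 2. $\phi^{\mathrm{mix}}_n(x_1,\dots,x_n)$ with $n\ge 3$. Here the variables in a clause are chosen among the $k$ variables that stand for the coordinates of $R$ and need not be distinct; the empty disjunction is false and the empty conjunction is true. Moreover, for every $n\ge 3$, the formula $\phi^{\mathrm{mix}}_n$ defines the relation $$R^{\mathrm{mix}}_n=\{(a_1,\dots,a_n)\in\mathbb{Q}^n\mid \min(a_3,\dots,a_n)\ge\min(a_1,a_2)\Rightarrow a_1=a_2\}.$$ -/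

import Mathlib

/-- The relation symbols of the signature `{<}`: a single binary symbol. -/
inductive LtRel : ℕ → Type
  | lt : LtRel 2

/-- The first-order language with the single binary relation symbol `<`. -/
abbrev ltLanguage : FirstOrder.Language := ⟨fun _ => Empty, LtRel⟩

/-- The structure `(ℚ; <)`. -/
instance ratLtStructure : ltLanguage.Structure ℚ where
  funMap := fun f _ => Empty.elim f
  RelMap := fun r => match r with
    | LtRel.lt => fun v => v 0 < v 1

/-- A `k`-ary relation on `ℚ` is temporal if it is first-order definable (without parameters)
in `(ℚ; <)`. -/
def IsTemporal {k : ℕ} (R : Set (Fin k → ℚ)) : Prop :=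
  (∅ : Set ℚ).Definable ltLanguage R

/-- The `m`-ary operation `f` on `A` preserves the `k`-ary relation `R` if applying `f`
componentwise to any `m` tuples of `R` gives a tuple of `R`. -/
def Preserves {A : Type*} {m k : ℕ} (f : (Fin m → A) → A) (R : Set (Fin k → A)) : Prop :=
  ∀ t : Fin m → (Fin k → A), (∀ j, t j ∈ R) → (fun i => f (fun j => t j i)) ∈ R

/-- The admissible triples `α, β, γ` in the definition of `mix`: endomorphisms of `(ℚ; <)` with
`γ(a) < α(a) < β(a) < γ(a + ε)` for all `a` and all `ε > 0`. -/
structure IsMixTriple (α β γ : ℚ → ℚ) : Prop where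
  strictMono_α : StrictMono α
  strictMono_β : StrictMono β
  strictMono_γ : StrictMono γ
  γ_lt_α : ∀ a, γ a < α a
  α_lt_β : ∀ a, α a < β a
  β_lt_γ : ∀ a ε, 0 < ε → β a < γ (a + ε)

/-- The binary operation `mix` built from `α, β, γ`. -/
def mix (α β γ : ℚ → ℚ) (x y : ℚ) : ℚ :=
  if x < y then α x else if x = y then β x else γ y

/-- The operation `mix` as a function on pairs, written as `Fin 2`-tuples. -/
def mixOp (α β γ : ℚ → ℚ) (p : Fin 2 → ℚ) : ℚ := mix α β γ (p 0) (p 1)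

/-- The set of indices of `a₃, …, aₙ` is nonempty. -/
theorem rmix_index_nonempty {n : ℕ} (hn : 3 ≤ n) :
    (Finset.univ.filter (fun i : Fin n => 2 ≤ i.val)).Nonempty :=
  Finset.filter_nonempty_iff.2 ⟨⟨2, by omega⟩, Finset.mem_univ _, le_refl 2⟩

/-- The relation `R^mix_n`, `n ≥ 3`: all tuples `(a₁, …, aₙ)` for which
`min(a₃, …, aₙ) ≥ min(a₁, a₂)` implies `a₁ = a₂`. The entry `aᵢ` is `a ⟨i - 1, _⟩`. -/
def RMix {n : ℕ} (hn : 3 ≤ n) : Set (Fin n → ℚ) :=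
  {a | min (a ⟨0, by omega⟩) (a ⟨1, by omega⟩) ≤
        (Finset.univ.filter (fun i : Fin n => 2 ≤ i.val)).inf' (rmix_index_nonempty hn) a →
      a ⟨0, by omega⟩ = a ⟨1, by omega⟩}

/-- The formula `φ^mix_n(x₁, …, xₙ)`, `n ≥ 3`, evaluated at `xᵢ = a ⟨i - 1, _⟩`:
`(x₁ ≥ x₂ ∨ ⋁_{i ≥ 3} x₁ > xᵢ) ∧ (x₂ ≥ x₁ ∨ ⋁_{i ≥ 3} x₂ > xᵢ)`. -/
def phiMix {n : ℕ} (hn : 3 ≤ n) (a : Fin n → ℚ) : Prop :=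
  (a ⟨0, by omega⟩ ≥ a ⟨1, by omega⟩ ∨ ∃ i : Fin n, 2 ≤ i.val ∧ a ⟨0, by omega⟩ > a i) ∧
  (a ⟨1, by omega⟩ ≥ a ⟨0, by omega⟩ ∨ ∃ i : Fin n, 2 ≤ i.val ∧ a ⟨1, by omega⟩ > a i)

/-- The clauses of the normal form, with variables from `V`. Variables may be repeated. -/
inductive MixClause (V : Type)
  /-- `x ≠ z₁ ∨ … ∨ x ≠ zₙ ∨ x > y₁ ∨ … ∨ x > yₘ`, with `n, m ≥ 0`. -/
  | neqGt (x : V) (n m : ℕ) (z : Fin n → V) (y : Fin m → V) : MixClause V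
  /-- `φ^mix_n(v₁, …, vₙ)`, with `n ≥ 3`. -/
  | phi (n : ℕ) (hn : 3 ≤ n) (v : Fin n → V) : MixClause V

/-- Satisfaction of a clause by an assignment of rationals to the variables. -/
def MixClause.Sat {V : Type} (t : V → ℚ) : MixClause V → Prop
  | .neqGt x _ _ z y => (∃ i, t x ≠ t (z i)) ∨ (∃ j, t x > t (y j))
  | .phi _ hn v => phiMix hn (fun i => t (v i))

/-- `R` is defined by the (finite) conjunction of the clauses in the list `Φ`, whose variables
`x₁, …, x_k` stand for the coordinates of `R`. -/
def DefinedBy {k : ℕ} (R : Set (Fin k → ℚ)) (Φ : List (MixClause (Fin k))) : Prop :=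
  R = {t | ∀ C ∈ Φ, C.Sat t}

/-! Truth in `(ℚ; <)` depends only on the order type of a tuple. The operation `mix` sends `(x, y)`
into the block `γ c < α c < β c` of `c = min x y`, and the position in the block records whether
only `y`, only `x` or both equal `c`. This makes the clauses invariant (`MixClause.sat_mix`).
Conversely, once two tuples are translated to a common minimum, it makes the minimum sets of tuples
of `R` closed under nonempty differences (`sdiff_mem_argminSets`).

If `s` satisfies all clauses valid in `R`, a tuple of `R` ordered like `s` is built by adding the
levels of `s` from top to bottom (`mem_of_forall_sat`). Let `L` be the lowest level of an upper set
`U`. Clauses of form 1 give a minimum set over `U` covering `L`; those of form 2 give minimum sets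
separating points of `L` from points of `U` outside `L`. By `mem_of_separated`, `L` is itself a
minimum set, and `mix` glues it below the tuple found so far (`exists_sameOrder_union`). -/

/-! ### Order types and first-order definability -/

/-- Two families of rationals with the same index set are ordered in the same way. -/
def SameOrder {ι : Type*} (v w : ι → ℚ) : Prop :=
  ∀ i j, v i < v j ↔ w i < w j

namespace SameOrder

variable {ι : Type*} {v w : ι → ℚ}

theorem symm (h : SameOrder v w) : SameOrder w v := fun i j => (h i j).symm

theorem eq_iff (h : SameOrder v w) (i j : ι) : v i = v j ↔ w i = w j := by
  have h1 := h i j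
  have h2 := h j i
  constructor
  · intro e
    exact le_antisymm (not_lt.1 fun hh => (h2.2 hh).ne e.symm)
      (not_lt.1 fun hh => (h1.2 hh).ne e)
  · intro e
    exact le_antisymm (not_lt.1 fun hh => (h2.1 hh).ne e.symm)
      (not_lt.1 fun hh => (h1.1 hh).ne e)

/-- The extension step of the back-and-forth argument in `ℚ`. -/
theorem exists_extension [Finite ι] (h : SameOrder v w) (a : ℚ) :
    ∃ b : ℚ, ∀ i, (v i < a ↔ w i < b) ∧ (a < v i ↔ b < w i) := by
  classical
  have := Fintype.ofFinite ι
  by_cases ha : ∃ i, v i = a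
  · obtain ⟨i, rfl⟩ := ha
    exact ⟨w i, fun j => ⟨h j i, h i j⟩⟩
  push Not at ha
  obtain ⟨b, hlo, hhi⟩ := Order.exists_between_finsets
    (lo := (Finset.univ.filter fun i => v i < a).image w)
    (hi := (Finset.univ.filter fun i => a < v i).image w) (by
      simp only [Finset.mem_image, Finset.mem_filter, Finset.mem_univ, true_and]
      rintro _ ⟨i, hi, rfl⟩ _ ⟨j, hj, rfl⟩
      exact (h i j).1 (hi.trans hj))
  simp only [Finset.mem_image, Finset.mem_filter, Finset.mem_univ, true_and,
    forall_exists_index, and_imp, forall_apply_eq_imp_iff₂] at hlo hhi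
  refine ⟨b, fun i => ?_⟩
  rcases lt_or_gt_of_ne (ha i) with hi | hi
  · have := hlo i hi
    exact ⟨iff_of_true hi this, iff_of_false hi.not_gt this.not_gt⟩
  · have := hhi i hi
    exact ⟨iff_of_false hi.not_gt this.not_gt, iff_of_true hi this⟩

theorem snoc {κ : Type*} {n : ℕ} {v w : κ → ℚ} {xs ys : Fin n → ℚ}
    (h : SameOrder (Sum.elim v xs) (Sum.elim w ys)) {a b : ℚ}
    (hab : ∀ i, (Sum.elim v xs i < a ↔ Sum.elim w ys i < b) ∧
      (a < Sum.elim v xs i ↔ b < Sum.elim w ys i)) :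
    SameOrder (Sum.elim v (Fin.snoc xs a : Fin (n + 1) → ℚ))
      (Sum.elim w (Fin.snoc ys b : Fin (n + 1) → ℚ)) := by
  have h1 := fun i => hab (.inl i)
  have h2 := fun i => hab (.inr i)
  have h3 := fun i j => h (.inl i) (.inl j)
  have h4 := fun i j => h (.inl i) (.inr j)
  have h5 := fun i j => h (.inr i) (.inl j)
  have h6 := fun i j => h (.inr i) (.inr j)
  simp only [Sum.elim_inl, Sum.elim_inr] at h1 h2 h3 h4 h5 h6
  rintro (i | i) (j | j)
  · exact h3 i j
  · refine Fin.lastCases ?_ (fun j => ?_) j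
    · simpa using (h1 i).1
    · simpa using h4 i j
  · refine Fin.lastCases ?_ (fun i => ?_) i
    · simpa using (h1 j).2
    · simpa using h5 i j
  · refine Fin.lastCases ?_ (fun i => ?_) i <;> refine Fin.lastCases ?_ (fun j => ?_) j
    · simp
    · simpa using (h2 j).2
    · simpa using (h2 i).1
    · simpa using h6 i j

/-- Back-and-forth: terms are variables, and `exists_extension` supplies witnesses for the
quantifier in either direction. -/
theorem realize_iff {κ : Type*} [Finite κ] {n : ℕ} (φ : ltLanguage.BoundedFormula κ n) :
    ∀ {v w : κ → ℚ} {xs ys : Fin n → ℚ}, SameOrder (Sum.elim v xs) (Sum.elim w ys) →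
      (φ.Realize v xs ↔ φ.Realize w ys) := by
  induction φ with
  | falsum => intros; rfl
  | equal t₁ t₂ =>
    intro v w xs ys h
    rcases t₁ with i | ⟨f, _⟩
    · rcases t₂ with j | ⟨f, _⟩
      · exact h.eq_iff i j
      · exact f.elim
    · exact f.elim
  | rel R ts =>
    intro v w xs ys h
    cases R
    have key {σ : Type _} (t : ltLanguage.Term σ) : ∃ i, ∀ x : σ → ℚ, t.realize x = x i := by
      rcases t with i | ⟨f, _⟩
      · exact ⟨i, fun _ => rfl⟩
      · exact f.elim
    obtain ⟨i, hi⟩ := key (ts 0)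
    obtain ⟨j, hj⟩ := key (ts 1)
    change (ts 0).realize _ < (ts 1).realize _ ↔ (ts 0).realize _ < (ts 1).realize _
    rw [hi, hi, hj, hj]
    exact h i j
  | imp φ ψ hφ hψ =>
    intro v w xs ys h
    exact imp_congr (hφ h) (hψ h)
  | all φ hφ =>
    intro v w xs ys h
    constructor
    · intro H b
      obtain ⟨a, ha⟩ := h.symm.exists_extension b
      exact (hφ (h.symm.snoc ha)).2 (H a)
    · intro H a
      obtain ⟨b, hb⟩ := h.exists_extension a
      exact (hφ (h.snoc hb)).2 (H b)

end SameOrder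

/-- A temporal relation contains every tuple that is ordered like one of its members. -/
theorem IsTemporal.mem_of_sameOrder {k : ℕ} {R : Set (Fin k → ℚ)} (hR : IsTemporal R)
    {t u : Fin k → ℚ} (ht : t ∈ R) (h : SameOrder t u) : u ∈ R := by
  obtain ⟨φ, rfl⟩ := Set.empty_definable_iff.1 hR
  refine (SameOrder.realize_iff φ ?_).1 ht
  rintro (i | i) (j | j)
  · exact h i j
  · exact j.elim0
  · exact i.elim0
  · exact i.elim0

/-! ### Position of the values of `mix` in the blocks -/

namespace IsMixTriple

variable {α β γ : ℚ → ℚ}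

theorem β_lt_γ' (h : IsMixTriple α β γ) {a b : ℚ} (hab : a < b) : β a < γ b := by
  simpa using h.β_lt_γ a (b - a) (sub_pos.2 hab)

/-- The facts that determine the order among the values at two points. -/
theorem compare (h : IsMixTriple α β γ) (a b : ℚ) :
    (γ a < α a ∧ α a < β a) ∧ (γ b < α b ∧ α b < β b) ∧ (a < b → β a < γ b) ∧
      (b < a → β b < γ a) :=
  ⟨⟨h.γ_lt_α a, h.α_lt_β a⟩, ⟨h.γ_lt_α b, h.α_lt_β b⟩, h.β_lt_γ', h.β_lt_γ'⟩

/-- Blocks `γ c < α c < β c` for distinct `c` do not interleave, so comparing `mix` with a block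
element is a finite case check on the order of `c`, `x`, `y`. -/
theorem γ_le_mix (h : IsMixTriple α β γ) {c x y : ℚ} :
    γ c ≤ mix α β γ x y ↔ c ≤ x ∧ c ≤ y := by
  obtain ⟨hc, hx, hcx, hxc⟩ := h.compare c x
  obtain ⟨-, hy, hcy, hyc⟩ := h.compare c y
  clear h
  unfold mix
  grind

theorem mix_eq_γ (h : IsMixTriple α β γ) {c x y : ℚ} :
    mix α β γ x y = γ c ↔ y = c ∧ c < x := by
  obtain ⟨hc, hx, hcx, hxc⟩ := h.compare c x
  obtain ⟨-, hy, hcy, hyc⟩ := h.compare c y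
  clear h
  unfold mix
  grind

theorem α_le_mix (h : IsMixTriple α β γ) {c x y : ℚ} :
    α c ≤ mix α β γ x y ↔ c ≤ x ∧ c ≤ y ∧ (y = c → x = c) := by
  obtain ⟨hc, hx, hcx, hxc⟩ := h.compare c x
  obtain ⟨-, hy, hcy, hyc⟩ := h.compare c y
  clear h
  unfold mix
  grind

theorem mix_eq_α (h : IsMixTriple α β γ) {c x y : ℚ} :
    mix α β γ x y = α c ↔ x = c ∧ c < y := by
  obtain ⟨hc, hx, hcx, hxc⟩ := h.compare c x
  obtain ⟨-, hy, hcy, hyc⟩ := h.compare c y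
  clear h
  unfold mix
  grind

theorem β_le_mix (h : IsMixTriple α β γ) {c x y : ℚ} :
    β c ≤ mix α β γ x y ↔ c ≤ x ∧ c ≤ y ∧ (x = c ↔ y = c) := by
  obtain ⟨hc, hx, hcx, hxc⟩ := h.compare c x
  obtain ⟨-, hy, hcy, hyc⟩ := h.compare c y
  clear h
  unfold mix
  grind

theorem mix_eq_β (h : IsMixTriple α β γ) {c x y : ℚ} :
    mix α β γ x y = β c ↔ x = c ∧ y = c := by
  obtain ⟨hc, hx, hcx, hxc⟩ := h.compare c x
  obtain ⟨-, hy, hcy, hyc⟩ := h.compare c y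
  clear h
  unfold mix
  grind

end IsMixTriple
-- Invariance of the clauses under `mix`
-- A failing conjunct makes one of the first two entries a lower bound that the other does not
-- attain. This form suits `mix`, which acts on minimum sets.
theorem phiMix_iff {n : ℕ} (hn : 3 ≤ n) (a : Fin n → ℚ) :
    phiMix hn a ↔ ∀ m, (∀ i, m ≤ a i) → (a ⟨0, by omega⟩ = m ↔ a ⟨1, by omega⟩ = m) := by
  constructor
  · rintro ⟨h1, h2⟩ m hm
    have m0 := hm ⟨0, by omega⟩
    have m1 := hm ⟨1, by omega⟩
    constructor
    · rintro rfl
      rcases h1 with h1 | ⟨i, -, h1⟩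
      · exact le_antisymm h1 m1
      · exact absurd h1 (hm i).not_gt
    · rintro rfl
      rcases h2 with h2 | ⟨i, -, h2⟩
      · exact le_antisymm h2 m0
      · exact absurd h2 (hm i).not_gt
  · intro h
    have key : ∀ m, m ≤ a ⟨0, by omega⟩ → m ≤ a ⟨1, by omega⟩ →
        (∀ i : Fin n, 2 ≤ i.val → m ≤ a i) → ∀ i, m ≤ a i := by
      intro m h0 h1 h2 i
      obtain ⟨_ | _ | i, hi⟩ := i
      · exact h0
      · exact h1
      · exact h2 _ (by simp)
    constructor
    · by_contra! hc
      exact hc.1.ne' ((h _ (key _ le_rfl hc.1.le hc.2)).1 rfl)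
    · by_contra! hc
      exact hc.1.ne' ((h _ (key _ hc.1.le le_rfl hc.2)).2 rfl)

theorem RMix_eq_phiMix {n : ℕ} (hn : 3 ≤ n) : RMix hn = {a | phiMix hn a} := by
  ext a
  simp only [RMix, Set.mem_ofPred_eq, phiMix_iff, Finset.le_inf'_iff, Finset.mem_filter,
    Finset.mem_univ, true_and]
  constructor
  · intro h m hm
    have m0 := hm ⟨0, by omega⟩
    have m1 := hm ⟨1, by omega⟩
    constructor
    · rintro rfl
      exact (h fun i _ => (min_le_left _ _).trans (hm i)).symm
    · rintro rfl
      exact h fun i _ => (min_le_right _ _).trans (hm i)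
  · intro h hle
    have key : ∀ i, min (a ⟨0, by omega⟩) (a ⟨1, by omega⟩) ≤ a i := by
      intro i
      obtain ⟨_ | _ | i, hi⟩ := i
      · exact min_le_left _ _
      · exact min_le_right _ _
      · exact hle _ (by simp)
    have := h _ key
    grind

theorem MixClause.sat_mix {V : Type} {α β γ : ℚ → ℚ} (h : IsMixTriple α β γ) (C : MixClause V)
    {p q : V → ℚ} (hp : C.Sat p) (hq : C.Sat q) : C.Sat (fun i => mix α β γ (p i) (q i)) := by
  cases C with
  | neqGt x n m z y =>
    by_contra hc
    simp only [MixClause.Sat, not_or, not_exists, not_not, not_lt, gt_iff_lt] at hc hp hq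
    obtain ⟨hz, hy⟩ := hc
    -- The literals refuted by the `mix` tuple are already refuted by `p` in the `α` and `β` blocks,
    -- and by `q` in the `γ` block.
    rcases lt_trichotomy (p x) (q x) with hx | hx | hx
    · rw [h.mix_eq_α.2 ⟨rfl, hx⟩] at hz hy
      rcases hp with ⟨i, hi⟩ | ⟨j, hj⟩
      · exact hi (h.mix_eq_α.1 (hz i).symm).1.symm
      · exact hj.not_ge (h.α_le_mix.1 (hy j)).1
    · rw [h.mix_eq_β.2 ⟨rfl, hx.symm⟩] at hz hy
      rcases hp with ⟨i, hi⟩ | ⟨j, hj⟩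
      · exact hi (h.mix_eq_β.1 (hz i).symm).1.symm
      · exact hj.not_ge (h.β_le_mix.1 (hy j)).1
    · rw [h.mix_eq_γ.2 ⟨rfl, hx⟩] at hz hy
      rcases hq with ⟨i, hi⟩ | ⟨j, hj⟩
      · exact hi (h.mix_eq_γ.1 (hz i).symm).1.symm
      · exact hj.not_ge (h.γ_le_mix.1 (hy j)).2
  | phi n hn v =>
    simp only [MixClause.Sat, phiMix_iff] at hp hq ⊢
    intro m hm
    suffices ∀ j k : Fin n, (∀ c, (∀ i, c ≤ p (v i)) → (p (v j) = c ↔ p (v k) = c)) →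
        (∀ c, (∀ i, c ≤ q (v i)) → (q (v j) = c ↔ q (v k) = c)) →
        mix α β γ (p (v j)) (q (v j)) = m → mix α β γ (p (v k)) (q (v k)) = m from
      ⟨this _ _ hp hq, this _ _ (fun c hc => (hp c hc).symm) (fun c hc => (hq c hc).symm)⟩
    intro j k hp hq hjm
    rcases lt_trichotomy (p (v j)) (q (v j)) with hx | hx | hx
    · obtain rfl := (h.mix_eq_α.2 ⟨rfl, hx⟩).symm.trans hjm
      have H := fun i => h.α_le_mix.1 (hm i)
      have h1 := hp _ fun i => (H i).1
      have h2 := hq _ fun i => (H i).2.1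
      have hk := H k
      rw [h.mix_eq_α]
      grind
    · obtain rfl := (h.mix_eq_β.2 ⟨rfl, hx.symm⟩).symm.trans hjm
      have H := fun i => h.β_le_mix.1 (hm i)
      have h1 := hp _ fun i => (H i).1
      have h2 := hq _ fun i => (H i).2.1
      have hk := H k
      rw [h.mix_eq_β]
      grind
    · obtain rfl := (h.mix_eq_γ.2 ⟨rfl, hx⟩).symm.trans hjm
      have H := fun i => h.γ_le_mix.1 (hm i)
      have h1 := hp _ fun i => (H i).1
      have h2 := hq _ fun i => (H i).2
      have hk := H k
      rw [h.mix_eq_γ]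
      grind

theorem DefinedBy.preserves_mixOp {k : ℕ} {R : Set (Fin k → ℚ)} {Φ : List (MixClause (Fin k))}
    (hΦ : DefinedBy R Φ) {α β γ : ℚ → ℚ} (h : IsMixTriple α β γ) :
    Preserves (mixOp α β γ) R := by
  intro t ht
  simp only [DefinedBy] at hΦ
  subst hΦ
  exact fun C hC => C.sat_mix h (ht 0 C hC) (ht 1 C hC)

theorem Preserves.mix_mem {k : ℕ} {R : Set (Fin k → ℚ)} {α β γ : ℚ → ℚ}
    (h : Preserves (mixOp α β γ) R) {p q : Fin k → ℚ} (hp : p ∈ R) (hq : q ∈ R) :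
    (fun i => mix α β γ (p i) (q i)) ∈ R := by
  refine h ![p, q] fun j => ?_
  fin_cases j
  · exact hp
  · exact hq

/-! ### Set families closed under differences -/

/-- A family of finite sets that is closed under nonempty differences contains a set `L` as soon
as one member covers `L` and members separate the points of `L` from the points outside `L`. -/
theorem mem_of_separated {ι : Type*} [DecidableEq ι] {F : Set (Finset ι)}
    (hF : ∀ A ∈ F, ∀ B ∈ F, (A \ B).Nonempty → A \ B ∈ F) {L : Finset ι} (hL : L.Nonempty)
    (hcov : ∃ A ∈ F, L ⊆ A)
    (hsep : ∀ a ∈ L, ∀ A ∈ F, ∀ b ∈ A, b ∉ L → ∃ B ∈ F, ¬(a ∈ B ↔ b ∈ B)) : L ∈ F := by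
  have hinter : ∀ A ∈ F, ∀ B ∈ F, (A ∩ B).Nonempty → A ∩ B ∈ F := by
    intro A hA B hB hne
    by_cases hd : (A \ B).Nonempty
    · rw [← Finset.sdiff_sdiff_self_left] at hne ⊢
      exact hF A hA _ (hF A hA B hB hd) hne
    · rw [Finset.not_nonempty_iff_eq_empty, Finset.sdiff_eq_empty_iff_subset] at hd
      rwa [Finset.inter_eq_left.2 hd]
  obtain ⟨A, hA, hLA⟩ := hcov
  induction A using Finset.strongInduction with
  | H A ih =>
    by_cases hAL : A ⊆ L
    · rwa [hLA.antisymm hAL]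
    obtain ⟨b, hbA, hbL⟩ := Finset.not_subset.1 hAL
    -- A separating set may be chosen to contain `b`: otherwise replace `B` by `A \ B`.
    have hsep' : ∀ a ∈ L, ∃ B ∈ F, b ∈ B ∧ a ∉ B := by
      intro a ha
      obtain ⟨B, hB, hab⟩ := hsep a ha A hA b hbA hbL
      by_cases hb : b ∈ B
      · exact ⟨B, hB, hb, by tauto⟩
      · exact ⟨A \ B, hF A hA B hB ⟨b, by simp [hbA, hb]⟩, by simp [hbA, hb], by simp; tauto⟩
    have hdisj : ∀ S ⊆ L, ∃ B ∈ F, b ∈ B ∧ Disjoint S B := by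
      intro S
      induction S using Finset.induction_on with
      | empty => exact fun _ => ⟨A, hA, hbA, Finset.disjoint_empty_left _⟩
      | insert a S _ ihS =>
        intro hS
        obtain ⟨B, hB, hbB, hSB⟩ := ihS ((Finset.subset_insert a S).trans hS)
        obtain ⟨C, hC, hbC, haC⟩ := hsep' a (hS (Finset.mem_insert_self a S))
        refine ⟨B ∩ C, hinter B hB C hC ⟨b, by simp [hbB, hbC]⟩, by simp [hbB, hbC], ?_⟩
        rw [Finset.disjoint_insert_left]
        exact ⟨by simp [haC], hSB.mono_right Finset.inter_subset_left⟩
    obtain ⟨B, hB, hbB, hLB⟩ := hdisj L subset_rfl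
    -- Removing `B` discards `b` but nothing of `L`, so the cover shrinks strictly.
    have hLAB : L ⊆ A \ B := Finset.subset_sdiff.2 ⟨hLA, hLB⟩
    exact ih (A \ B) (Finset.ssubset_iff_of_subset Finset.sdiff_subset |>.2
      ⟨b, hbA, by simp [hbB]⟩) (hF A hA B hB (hL.mono hLAB)) hLAB

/-- The sets of indices in `U` at which some tuple of `R` attains its minimum over `U`. -/
def argminSets {ι : Type*} (R : Set (ι → ℚ)) (U : Finset ι) : Set (Finset ι) :=
  {A | A ⊆ U ∧ A.Nonempty ∧ ∃ t ∈ R, ∃ c, ∀ x ∈ U, c ≤ t x ∧ (t x = c ↔ x ∈ A)}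

/-! ### Relations preserved by `mix` -/

section ClosedUnderMix

variable {k : ℕ} {R : Set (Fin k → ℚ)} {α β γ : ℚ → ℚ}

theorem sdiff_mem_argminSets (hR : ∀ t ∈ R, ∀ u, SameOrder t u → u ∈ R)
    (h : IsMixTriple α β γ) (hp : Preserves (mixOp α β γ) R) {U A B : Finset (Fin k)}
    (hA : A ∈ argminSets R U) (hB : B ∈ argminSets R U) (hne : (A \ B).Nonempty) :
    A \ B ∈ argminSets R U := by
  obtain ⟨hAU, -, t, ht, c, htc⟩ := hA
  obtain ⟨-, -, u, hu, d, hud⟩ := hB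
  -- With both minima at `c`, `mix` takes the value `γ c` exactly where the second argument is `c`
  -- and the first is larger.
  have hu' : (fun i => u i - d + c) ∈ R := hR u hu _ fun i j => by simp
  refine ⟨Finset.sdiff_subset.trans hAU, hne, _, hp.mix_mem hu' ht, γ c, fun x hx => ?_⟩
  have h1 := htc x hx
  have h2 := hud x hx
  rw [h.γ_le_mix, h.mix_eq_γ, Finset.mem_sdiff, ← h1.2, ← h2.2]
  refine ⟨⟨by linarith, h1.1⟩, and_congr_right fun _ => ?_⟩
  constructor
  · intro h3 h4
    linarith
  · intro h3
    have := lt_of_le_of_ne h2.1 (Ne.symm h3)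
    linarith

/-- If a tuple of `R` is constant on `L` and larger on `U`, and another one is ordered like `s` on
`U`, then `R` has a tuple ordered like `s` on `U ∪ L`. -/
theorem exists_sameOrder_union (hR : ∀ t ∈ R, ∀ u, SameOrder t u → u ∈ R)
    (h : IsMixTriple α β γ) (hp : Preserves (mixOp α β γ) R) {s t u : Fin k → ℚ}
    {U L : Finset (Fin k)} (ht : t ∈ R) (hu : u ∈ R) {c : ℚ} (htL : ∀ x ∈ L, t x = c)
    (htU : ∀ x ∈ U, c < t x) (huU : ∀ x ∈ U, ∀ y ∈ U, u x < u y ↔ s x < s y)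
    (hsL : ∀ x ∈ L, ∀ y ∈ L, s x = s y) (hsLU : ∀ x ∈ L, ∀ y ∈ U, s x < s y) :
    ∃ w ∈ R, ∀ x ∈ U ∪ L, ∀ y ∈ U ∪ L, w x < w y ↔ s x < s y := by
  classical
  obtain ⟨d, hcd, hd⟩ := Order.exists_between_finsets (lo := {c}) (hi := U.image t) (by
    simpa using htU)
  simp only [Finset.mem_singleton, forall_eq, Finset.mem_image, forall_exists_index, and_imp,
    forall_apply_eq_imp_iff₂] at hcd hd
  obtain ⟨B, hB0, hB⟩ : ∃ B : ℚ, 0 < B ∧ ∀ x, |u x| < B := by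
    refine ⟨1 + ∑ x, |u x|, by positivity, fun x => ?_⟩
    have := Finset.single_le_sum (f := fun x => |u x|) (fun i _ => abs_nonneg _)
      (Finset.mem_univ x)
    linarith
  set r : ℚ := (d - c) / (2 * B) with hr
  have hr0 : 0 < r := by have := sub_pos.2 hcd; positivity
  have hrB : r * (2 * B) = d - c := by rw [hr]; field_simp
  -- `u` is squeezed into the interval `(c, d)`: above `t` on `L`, below `t` on `U`. Hence `mix t
  -- u'` is `α c` on `L` and `γ (u' x)` on `U`.
  set u' : Fin k → ℚ := fun x => c + r * (u x + B) with hu'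
  have hlt : ∀ x y, u' x < u' y ↔ u x < u y := fun x y => by
    simp [hu', mul_lt_mul_iff_right₀ hr0]
  have hcu : ∀ x, c < u' x := fun x => by
    have := (abs_lt.1 (hB x)).1
    have : 0 < r * (u x + B) := mul_pos hr0 (by linarith)
    simp only [hu']
    linarith
  have hud : ∀ x, u' x < d := fun x => by
    have := (abs_lt.1 (hB x)).2
    have : r * (u x + B) < r * (2 * B) := mul_lt_mul_of_pos_left (by linarith) hr0
    simp only [hu']
    linarith
  have hu'R : u' ∈ R := hR u hu _ fun i j => (hlt i j).symm
  refine ⟨_, hp.mix_mem ht hu'R, ?_⟩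
  have hwL : ∀ x ∈ L, mix α β γ (t x) (u' x) = α c := fun x hx =>
    h.mix_eq_α.2 ⟨htL x hx, hcu x⟩
  have hwU : ∀ x ∈ U, mix α β γ (t x) (u' x) = γ (u' x) := fun x hx =>
    h.mix_eq_γ.2 ⟨rfl, (hud x).trans (hd x hx)⟩
  have hcγ : ∀ x, α c < γ (u' x) := fun x => (h.α_lt_β c).trans (h.β_lt_γ' (hcu x))
  intro x hx y hy
  rcases Finset.mem_union.1 hx with hx | hx <;> rcases Finset.mem_union.1 hy with hy | hy
  · rw [hwU x hx, hwU y hy, h.strictMono_γ.lt_iff_lt, hlt, huU x hx y hy]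
  · rw [hwU x hx, hwL y hy]
    exact iff_of_false (hcγ x).not_gt (hsLU y hy x hx).not_gt
  · rw [hwL x hx, hwU y hy]
    exact iff_of_true (hcγ y) (hsLU x hx y hy)
  · rw [hwL x hx, hwL y hy, hsL x hx y hy]
    simp

/-- A tuple that satisfies every clause valid in `R` belongs to `R`, if `R` is closed under
order-equivalence and preserved by `mix`. It suffices to consider clauses of bounded length. -/
theorem mem_of_forall_sat (hR : ∀ t ∈ R, ∀ u, SameOrder t u → u ∈ R)
    (h : IsMixTriple α β γ) (hp : Preserves (mixOp α β γ) R) (hne : R.Nonempty) {s : Fin k → ℚ}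
    (hgt : ∀ (x : Fin k) (z y : Fin k → Fin k),
      (∀ t ∈ R, (MixClause.neqGt x k k z y).Sat t) → (MixClause.neqGt x k k z y).Sat s)
    (hphi : ∀ v : Fin (k + 3) → Fin k,
      (∀ t ∈ R, (MixClause.phi (k + 3) (by omega) v).Sat t) →
        (MixClause.phi (k + 3) (by omega) v).Sat s) : s ∈ R := by
  classical
  suffices H : ∀ U : Finset (Fin k), (∀ x ∈ U, ∀ y, s x ≤ s y → y ∈ U) →
      ∃ t ∈ R, ∀ x ∈ U, ∀ y ∈ U, t x < t y ↔ s x < s y by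
    obtain ⟨t, ht, hts⟩ := H Finset.univ fun _ _ y _ => Finset.mem_univ y
    exact hR t ht s fun i j => hts i (Finset.mem_univ i) j (Finset.mem_univ j)
  intro U
  induction U using Finset.strongInduction with
  | H U ih =>
    intro hU
    rcases U.eq_empty_or_nonempty with rfl | hUne
    · obtain ⟨t, ht⟩ := hne
      exact ⟨t, ht, by simp⟩
    obtain ⟨a, haU, ha⟩ := U.exists_min_image s hUne
    have hmemU : ∀ y, y ∈ U ↔ s a ≤ s y := fun y => ⟨ha y, hU a haU y⟩
    set L := U.filter fun x => s x = s a with hL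
    set U' := U.filter fun x => s a < s x with hU'
    have hmemL : ∀ y, y ∈ L ↔ s y = s a := fun y => by
      simp only [hL, Finset.mem_filter, hmemU]
      exact ⟨And.right, fun hy => ⟨hy.ge, hy⟩⟩
    have hmemU' : ∀ y, y ∈ U' ↔ s a < s y := fun y => by
      simp only [hU', Finset.mem_filter, hmemU]
      exact ⟨And.right, fun hy => ⟨hy.le, hy⟩⟩
    have hunion : U' ∪ L = U := by
      ext y
      rw [Finset.mem_union, hmemL, hmemU', hmemU, le_iff_lt_or_eq, eq_comm (a := s y)]
    obtain ⟨u, hu, huU⟩ := ih U'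
      (Finset.filter_ssubset.2 ⟨a, haU, lt_irrefl _⟩)
      (fun x hx y hxy => (hmemU' y).2 (((hmemU' x).1 hx).trans_le hxy))
    have hLF : L ∈ argminSets R U := by
      refine mem_of_separated (fun A hA B hB hAB => sdiff_mem_argminSets hR h hp hA hB hAB)
        ⟨a, (hmemL a).2 rfl⟩ ?_ ?_
      · by_contra hc
        -- Unused slots are padded with `a`, which only adds the false literals `a ≠ a` and `a > a`.
        -- A tuple of `R` violating this clause has a minimum set covering `L`.
        have hs := hgt a (fun i => if s i = s a then i else a)
          (fun i => if s a ≤ s i then i else a) ?_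
        · rcases hs with ⟨i, hi⟩ | ⟨i, hi⟩ <;> dsimp only at hi
          · exact hi (by split_ifs with hh <;> simp [hh])
          · split_ifs at hi with hh
            · exact hi.not_ge hh
            · exact lt_irrefl _ hi
        · intro t ht
          by_contra hts
          simp only [MixClause.Sat, not_or, not_exists, not_not, not_lt, gt_iff_lt] at hts
          refine hc ⟨U.filter fun x => t x = t a, ⟨Finset.filter_subset _ _,
            ⟨a, by simp [haU]⟩, t, ht, t a, fun x hx => ⟨?_, by simp [hx]⟩⟩, fun x hx => ?_⟩
          · simpa [(hmemU x).1 hx] using hts.2 x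
          · have hx' := (hmemL x).1 hx
            simpa [hx', hmemU] using (hts.1 x).symm
      · intro x hx A hA b hbA hbL
        have hxa := (hmemL x).1 hx
        have hbU : b ∈ U := hA.1 hbA
        by_contra! hc
        -- The slots from the third on list `U`, shifted by two and padded with `x`. If no minimum
        -- set separates `x` from `b`, the clause is valid in `R`, yet `s` violates it.
        have hs := hphi (fun i => if i.val = 0 then x else if i.val = 1 then b else
          if hi : i.val - 2 < k then
            if s a ≤ s ⟨i.val - 2, hi⟩ then ⟨i.val - 2, hi⟩ else x else x) ?_
        · rw [MixClause.Sat, phiMix_iff] at hs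
          have := (hs (s a) fun i => ?_).1 (by simp [hxa])
          · exact hbL ((hmemL b).2 (by simpa using this))
          · have := (hmemU b).1 hbU
            split_ifs <;> first | assumption | exact hxa.ge
        · intro t ht
          rw [MixClause.Sat, phiMix_iff]
          intro m hm
          have hmU : ∀ y ∈ U, m ≤ t y := fun y hy => by
            simpa [(hmemU y).1 hy] using hm ⟨y.val + 2, by omega⟩
          have key : ∀ e ∈ U, t e = m → (t x = m ↔ t b = m) := by
            intro e heU he
            have := hc (U.filter fun y => t y = m) ⟨Finset.filter_subset _ _,
              ⟨e, by simp [heU, he]⟩, t, ht, m, fun y hy => ⟨hmU y hy, by simp [hy]⟩⟩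
            have hxU : x ∈ U := (hmemU x).2 hxa.ge
            simpa [hxU, hbU] using this
          have hxU : x ∈ U := (hmemU x).2 hxa.ge
          simp only [if_true, one_ne_zero, if_false]
          exact ⟨fun e => (key x hxU e).1 e, fun e => (key b hbU e).2 e⟩
    obtain ⟨-, -, t, ht, c, htc⟩ := hLF
    rw [← hunion]
    refine exists_sameOrder_union hR h hp ht hu (c := c) (fun x hx => ?_) (fun x hx => ?_) huU
      (fun x hx y hy => ((hmemL x).1 hx).trans ((hmemL y).1 hy).symm)
      (fun x hx y hy => ((hmemL x).1 hx).trans_lt ((hmemU' y).1 hy))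
    · exact ((htc x (Finset.mem_of_mem_filter x hx)).2).2 hx
    · have hxU := Finset.mem_of_mem_filter x hx
      refine lt_of_le_of_ne (htc x hxU).1 fun e => ?_
      have hxL := (htc x hxU).2.1 e.symm
      exact ((hmemU' x).1 hx).ne' ((hmemL x).1 hxL)

theorem Preserves.exists_definedBy (hk : 1 ≤ k) (hR : IsTemporal R) (h : IsMixTriple α β γ)
    (hp : Preserves (mixOp α β γ) R) : ∃ Φ : List (MixClause (Fin k)), DefinedBy R Φ := by
  classical
  rcases R.eq_empty_or_nonempty with rfl | hne
  -- The clause without literals is false, but it still needs a variable `x`, hence `1 ≤ k`.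
  · refine ⟨[.neqGt ⟨0, hk⟩ 0 0 Fin.elim0 Fin.elim0], ?_⟩
    simp [DefinedBy, MixClause.Sat]
  let Ψ : List (MixClause (Fin k)) :=
    (Finset.univ : Finset (Fin k × (Fin k → Fin k) × (Fin k → Fin k))).toList.map
      (fun p => .neqGt p.1 k k p.2.1 p.2.2) ++
    (Finset.univ : Finset (Fin (k + 3) → Fin k)).toList.map (.phi (k + 3) (by omega))
  refine ⟨Ψ.filter fun C => ∀ t ∈ R, C.Sat t, Set.Subset.antisymm (fun t ht C hC => ?_)
    fun s hs => ?_⟩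
  · have := (List.mem_filter.1 hC).2
    exact of_decide_eq_true this t ht
  · refine mem_of_forall_sat (fun t ht u => hR.mem_of_sameOrder ht) h hp hne
      (fun x z y hC => hs _ (List.mem_filter.2 ⟨?_, decide_eq_true hC⟩))
      (fun v hC => hs _ (List.mem_filter.2 ⟨?_, decide_eq_true hC⟩))
    · simp [Ψ]
    · simp [Ψ]

end ClosedUnderMix

theorem theorem4p5 :
    (∀ (α β γ : ℚ → ℚ), IsMixTriple α β γ →
      ∀ (k : ℕ), 1 ≤ k → ∀ (R : Set (Fin k → ℚ)), IsTemporal R →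
        (Preserves (mixOp α β γ) R ↔ ∃ Φ : List (MixClause (Fin k)), DefinedBy R Φ)) ∧
    (∀ (n : ℕ) (hn : 3 ≤ n), RMix hn = {a | phiMix hn a}) :=
  ⟨fun _ _ _ h _ hk _ hR => ⟨fun hp => hp.exists_definedBy hk hR h,
    fun ⟨_, hΦ⟩ => hΦ.preserves_mixOp h⟩, fun _ hn => RMix_eq_phiMix hn⟩
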